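/- Let $G$ be a torsion-free, non-elementary hyperbolic group (non-elementary: $G$ is infinite and has no finite-index subgroup isomorphic to $\mathbb{Z}$), and let $S$ be a finite generating set of $G$ with $S=S^{-1}$ and $e\notin S$. A weight on $S$ is a function $w\colon S\to(0,\infty)$ with $w(s)=w(s^{-1})$ for all $s\in S$; it is normalized if $\sum_{s\in S}w(s)=1$. Let $\mathcal{W}$ be the set of normalized weights on $S$. For a weight $w$ and $x,y\in G$ put $$d_w(x,y)=\min\Big\{\sum_{i=1}^n w(s_i) : n\ge 0,\ s_1,\dots,s_n\in S,\ s_1\cdots s_n=y^{-1}x\Big\},$$ let $B_w(R)=\{x\in G : d_w(x,e)\le R\}$, and let $$h(w)=\lim_{R\to\infty}\frac{\ln|B_w(R)|}{R}$$ be the volume entropy of $w$. Then: 1. For every weight $w$ on $S$, the limit defining $h(w)$ exists and is finite. 2. For every $N>0$ there is $\delta>0$ such that every $w\in\mathcal{W}$ with $\min_{s\in S}w(s)<\delta$ satisfies $h(w)>N$. 3. There is $w\in\mathcal{W}$ with $h(w)=\inf_{w'\in\mathcal{W}}h(w')$, that is, $h(w)\le h(w')$ for all $w'\in\mathcal{W}$.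 -/

import Mathlib

open Filter Topology

namespace WeightedWord

/-- `S` is a finite symmetric generating set of `G`. -/
structure IsSymmGenSet {G : Type*} [Group G] (S : Finset G) : Prop where
  inv_mem : ∀ s ∈ S, s⁻¹ ∈ S
  closure_eq_top : Subgroup.closure (S : Set G) = ⊤

/-- A weight on `S`: a positive function with `w (s⁻¹) = w s`. -/
structure IsWeight {G : Type*} [Group G] {S : Finset G} (w : S → ℝ) : Prop where
  pos : ∀ s, 0 < w s
  symm : ∀ s t : S, (t : G) = (s : G)⁻¹ → w t = w s

/-- The set of normalized weights on `S`: the weights of total mass one. -/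
def normalizedWeights {G : Type*} [Group G] (S : Finset G) : Set (S → ℝ) :=
  {w | IsWeight w ∧ ∑ s, w s = 1}

/-- The total weights of the words in `S` that represent `g`. -/
def wordWeights {G : Type*} [Group G] {S : Finset G} (w : S → ℝ) (g : G) : Set ℝ :=
  {r | ∃ l : List S, (l.map (fun s : S => (s : G))).prod = g ∧ (l.map w).sum = r}

/-- The weighted word metric `d_w (x, y)`: the least total weight of a word representing
`y⁻¹ x`. The minimum is attained, see `isLeast_weightedDist`. -/
noncomputable def weightedDist {G : Type*} [Group G] {S : Finset G} (w : S → ℝ) (x y : G) : ℝ :=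
  sInf (wordWeights w (y⁻¹ * x))

/-- The closed ball of radius `R` around the identity for `d_w`. -/
def weightedBall {G : Type*} [Group G] {S : Finset G} (w : S → ℝ) (R : ℝ) : Set G :=
  {x | weightedDist w x 1 ≤ R}

/-- The volume entropy `h(w) = lim_{R → ∞} ln |B_w(R)| / R`. -/
noncomputable def volumeEntropy {G : Type*} [Group G] {S : Finset G} (w : S → ℝ) : ℝ :=
  limUnder atTop (fun R : ℝ => Real.log ((weightedBall w R).ncard : ℝ) / R)

/-- The (unweighted) word metric with respect to `S`. -/
noncomputable def wordDist {G : Type*} [Group G] (S : Finset G) (x y : G) : ℝ :=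
  weightedDist (fun _ : S => (1 : ℝ)) x y

/-- The Gromov product `(x|y)_p` for a distance function `d`. -/
noncomputable def gromovProduct {X : Type*} (d : X → X → ℝ) (x y p : X) : ℝ :=
  (d x p + d y p - d x y) / 2

/-- The four point condition, for some `δ > 0`. -/
def IsHyperbolicDist {X : Type*} (d : X → X → ℝ) : Prop :=
  ∃ δ : ℝ, 0 < δ ∧ ∀ x y z p : X,
    min (gromovProduct d x z p) (gromovProduct d y z p) - δ ≤ gromovProduct d x y p

/-- `G` is a hyperbolic group: it is finitely generated, and the word metric of some finite
symmetric generating set is hyperbolic. -/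
def IsHyperbolicGroup (G : Type*) [Group G] : Prop :=
  ∃ T : Finset G, IsSymmGenSet T ∧ IsHyperbolicDist (wordDist T)

/-- `G` is infinite and has no finite-index subgroup isomorphic to `ℤ`. -/
def IsNonElementary (G : Type*) [Group G] : Prop :=
  Infinite G ∧ ¬ ∃ H : Subgroup G, H.FiniteIndex ∧ Nonempty (H ≃* Multiplicative ℤ)

/-- No element other than the identity has finite order. -/
def IsTorsionFreeGroup (G : Type*) [Group G] : Prop :=
  ∀ g : G, IsOfFinOrder g → g = 1

theorem wordWeights_nonempty {G : Type*} [Group G] {S : Finset G} (hS : IsSymmGenSet S)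
    (w : S → ℝ) (g : G) : (wordWeights w g).Nonempty := by
  suffices h : ∃ l : List S, (l.map (fun s : S => (s : G))).prod = g by
    obtain ⟨l, hl⟩ := h
    exact ⟨_, l, hl, rfl⟩
  have hg : g ∈ Subgroup.closure (S : Set G) := by rw [hS.closure_eq_top]; trivial
  induction hg using Subgroup.closure_induction'' with
  | mem x hx => exact ⟨[⟨x, hx⟩], by simp⟩
  | inv_mem x hx => exact ⟨[⟨x⁻¹, hS.inv_mem x hx⟩], by simp⟩
  | one => exact ⟨[], by simp⟩
  | mul x y _ _ hx hy =>
    obtain ⟨a, ha⟩ := hx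
    obtain ⟨b, hb⟩ := hy
    exact ⟨a ++ b, by rw [List.map_append, List.prod_append, ha, hb]⟩

/-- Only finitely many words have total weight at most `R`. -/
theorem finite_words {G : Type*} [Group G] {S : Finset G} {w : S → ℝ} (hw : IsWeight w) (R : ℝ) :
    {l : List S | (l.map w).sum ≤ R}.Finite := by
  obtain ⟨c, hc, hcw⟩ : ∃ c : ℝ, 0 < c ∧ ∀ s, c ≤ w s := by
    rcases isEmpty_or_nonempty S with h | h
    · exact ⟨1, one_pos, fun s => h.elim s⟩
    · obtain ⟨s, hs⟩ := Finite.exists_min w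
      exact ⟨w s, hw.pos s, hs⟩
  have key : ∀ l : List S, l.length * c ≤ (l.map w).sum := by
    intro l
    induction l with
    | nil => simp
    | cons a l ih =>
      have := hcw a
      simp only [List.length_cons, List.map_cons, List.sum_cons]
      push_cast
      linarith
  refine (List.finite_length_le S ⌊R / c⌋₊).subset fun l hl => Nat.le_floor ?_
  rw [le_div_iff₀ hc]
  exact (key l).trans hl

theorem isLeast_weightedDist {G : Type*} [Group G] {S : Finset G} (hS : IsSymmGenSet S)
    {w : S → ℝ} (hw : IsWeight w) (x y : G) :
    IsLeast (wordWeights w (y⁻¹ * x)) (weightedDist w x y) := by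
  obtain ⟨r, hr⟩ := wordWeights_nonempty hS w (y⁻¹ * x)
  have hfin : (wordWeights w (y⁻¹ * x) ∩ Set.Iic r).Finite := by
    refine ((finite_words hw r).image fun l => (l.map w).sum).subset ?_
    rintro t ⟨⟨l, -, rfl⟩, ht⟩
    exact ⟨l, ht, rfl⟩
  obtain ⟨m, hm, hmin⟩ := hfin.exists_minimalFor id _ ⟨r, hr, le_refl r⟩
  have hle : IsLeast (wordWeights w (y⁻¹ * x)) m := by
    refine ⟨hm.1, fun t ht => ?_⟩
    rcases le_total m t with h | h
    · exact h
    · exact hmin ⟨ht, h.trans hm.2⟩ h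
  rw [weightedDist, hle.csInf_eq]
  exact hle

/-- Balls are finite, so that `Set.ncard` is their actual cardinality. -/
theorem finite_weightedBall {G : Type*} [Group G] {S : Finset G} (hS : IsSymmGenSet S)
    {w : S → ℝ} (hw : IsWeight w) (R : ℝ) : (weightedBall w R).Finite := by
  refine ((finite_words hw R).image fun l => (l.map (fun s : S => (s : G))).prod).subset ?_
  intro x hx
  obtain ⟨l, hl, hlw⟩ := (isLeast_weightedDist hS hw x 1).1
  exact ⟨l, hlw.le.trans hx, by simpa using hl⟩

end WeightedWord

open WeightedWord

/-! A geodesic word can be cut near any prescribed length with an error of at most one letter. Hence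
`log |B_w(n + c)|`, with `c` the total weight, is subadditive, and Fekete's lemma gives the limit.

Blow-up is an exponential count. For `s` of infinite order there are `b` and `q > 0` such that
distinct words of equal length in the elements `b * s ^ (q * (k + 1))` have distinct products. If `w
s` is tiny, the first `M` of these elements cost at most a constant `C` independent of `w` and `M`,
so the entropy is at least `log M / C`. In a torsion-free group every letter `s ≠ 1` qualifies, and
`S` is finite. The statement about `b` and `q` mentions no metric, so it may be proved with
whichever generating set witnesses hyperbolicity and then used for `S`.

To find `b`, first show that some power of `s` is conjugate to a loxodromic `h`. If every `g` sent
the forward end of `h` to an end of `h`, all of `G` would lie within bounded distance of the powers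
of `h` and be virtually cyclic. Some `g` does not, and ping-pong with `g * h ^ (q * (k + 1))`
separates the products.

For the minimum, entropy is lower semicontinuous, and blow-up confines its small values to a compact
set of weights. -/

namespace WeightedWord

/-! ### Weighted word metrics and coarse geodesics -/

section Metric

variable {G : Type*} [Group G] {S : Finset G}

theorem weightedDist_le_of_word (hS : IsSymmGenSet S) {w : S → ℝ} (hw : IsWeight w) {x y : G}
    (l : List S) (hl : (l.map (fun s : S => (s : G))).prod = y⁻¹ * x) :
    weightedDist w x y ≤ (l.map w).sum :=
  (isLeast_weightedDist hS hw x y).2 ⟨l, hl, rfl⟩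

theorem exists_word_eq_weightedDist (hS : IsSymmGenSet S) {w : S → ℝ} (hw : IsWeight w)
    (x y : G) : ∃ l : List S, (l.map (fun s : S => (s : G))).prod = y⁻¹ * x ∧
      (l.map w).sum = weightedDist w x y :=
  (isLeast_weightedDist hS hw x y).1

theorem IsWeight.sum_nonneg {w : S → ℝ} (hw : IsWeight w) (l : List S) : 0 ≤ (l.map w).sum :=
  List.sum_nonneg fun x hx => by
    obtain ⟨s, -, rfl⟩ := List.mem_map.1 hx
    exact (hw.pos s).le

theorem weightedDist_nonneg (hS : IsSymmGenSet S) {w : S → ℝ} (hw : IsWeight w) (x y : G) :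
    0 ≤ weightedDist w x y := by
  obtain ⟨l, -, hl⟩ := exists_word_eq_weightedDist hS hw x y
  exact hl ▸ hw.sum_nonneg l

theorem weightedDist_self (hS : IsSymmGenSet S) {w : S → ℝ} (hw : IsWeight w) (x : G) :
    weightedDist w x x = 0 :=
  le_antisymm (by simpa using weightedDist_le_of_word hS hw (x := x) (y := x) [] (by simp))
    (weightedDist_nonneg hS hw x x)

theorem weightedDist_triangle (hS : IsSymmGenSet S) {w : S → ℝ} (hw : IsWeight w) (x y z : G) :
    weightedDist w x z ≤ weightedDist w x y + weightedDist w y z := by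
  obtain ⟨l, hl, hl'⟩ := exists_word_eq_weightedDist hS hw x y
  obtain ⟨k, hk, hk'⟩ := exists_word_eq_weightedDist hS hw y z
  refine (weightedDist_le_of_word hS hw (k ++ l) ?_).trans_eq ?_
  · rw [List.map_append, List.prod_append, hl, hk]; group
  · rw [List.map_append, List.sum_append, hl', hk', add_comm]

theorem weightedDist_mul_left (w : S → ℝ) (g x y : G) :
    weightedDist w (g * x) (g * y) = weightedDist w x y := by
  unfold weightedDist
  congr 2
  group

theorem weightedDist_comm_le (hS : IsSymmGenSet S) {w : S → ℝ} (hw : IsWeight w) (x y : G) :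
    weightedDist w y x ≤ weightedDist w x y := by
  obtain ⟨l, hl, hl'⟩ := exists_word_eq_weightedDist hS hw x y
  let i : S → S := fun s => ⟨(s : G)⁻¹, hS.inv_mem s s.2⟩
  refine (weightedDist_le_of_word hS hw (l.map i).reverse ?_).trans_eq ?_
  · have h : x⁻¹ * y = (y⁻¹ * x)⁻¹ := by group
    rw [h, ← hl, List.prod_inv_reverse, List.map_reverse, List.map_map, List.map_map]
    rfl
  · rw [← hl', List.map_reverse, List.sum_reverse, List.map_map]
    congr 1
    exact List.map_congr_left fun s _ => hw.symm s (i s) rfl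

theorem weightedDist_comm (hS : IsSymmGenSet S) {w : S → ℝ} (hw : IsWeight w) (x y : G) :
    weightedDist w x y = weightedDist w y x :=
  le_antisymm (weightedDist_comm_le hS hw y x) (weightedDist_comm_le hS hw x y)

theorem exists_append_of_le_sum {α : Type*} {w : α → ℝ} {c : ℝ} (hc : 0 ≤ c) (hwc : ∀ a, w a ≤ c)
    (l : List α) (R : ℝ) (hR : 0 ≤ R) (hl : R ≤ (l.map w).sum) :
    ∃ l₁ l₂, l = l₁ ++ l₂ ∧ R - c ≤ (l₁.map w).sum ∧ (l₁.map w).sum ≤ R := by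
  induction l generalizing R with
  | nil =>
    simp only [List.map_nil, List.sum_nil] at hl
    exact ⟨[], [], rfl, by simpa using by linarith, by simpa using hR⟩
  | cons a l ih =>
    rw [List.map_cons, List.sum_cons] at hl
    rcases lt_or_ge R (w a) with h | h
    · exact ⟨[], a :: l, rfl, by simpa using by linarith [hwc a], by simpa using hR⟩
    · obtain ⟨l₁, l₂, rfl, h₁, h₂⟩ := ih (R - w a) (by linarith) (by linarith)
      refine ⟨a :: l₁, l₂, rfl, ?_, ?_⟩ <;> rw [List.map_cons, List.sum_cons] <;> linarith

/-- A geodesic from `x` to `y` has a point at distance about `R` from `x`. -/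
theorem exists_between (hS : IsSymmGenSet S) {w : S → ℝ} (hw : IsWeight w) {c : ℝ} (hc : 0 ≤ c)
    (hwc : ∀ s, w s ≤ c) (x y : G) (R : ℝ) (hR : 0 ≤ R) (hRd : R ≤ weightedDist w x y) :
    ∃ z, weightedDist w x z + weightedDist w z y = weightedDist w x y ∧
      R - c ≤ weightedDist w x z ∧ weightedDist w x z ≤ R := by
  rw [weightedDist_comm hS hw] at hRd
  obtain ⟨l, hl, hl'⟩ := exists_word_eq_weightedDist hS hw y x
  obtain ⟨l₁, l₂, rfl, h₁, h₂⟩ := exists_append_of_le_sum hc hwc l R hR (hl'.symm ▸ hRd)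
  rw [List.map_append, List.prod_append] at hl
  rw [List.map_append, List.sum_append] at hl'
  set z := x * (l₁.map (fun s : S => (s : G))).prod with hz
  have e₁ : weightedDist w z x ≤ (l₁.map w).sum :=
    weightedDist_le_of_word hS hw l₁ (by rw [hz]; group)
  have e₂ : weightedDist w y z ≤ (l₂.map w).sum :=
    weightedDist_le_of_word hS hw l₂ (by
      rw [hz, mul_inv_rev, mul_assoc, ← hl]; group)
  have e₃ := weightedDist_triangle hS hw y z x
  refine ⟨z, ?_, ?_, ?_⟩
  · rw [weightedDist_comm hS hw x z, weightedDist_comm hS hw z y, weightedDist_comm hS hw x y]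
    linarith
  · rw [weightedDist_comm hS hw x z]; linarith
  · rw [weightedDist_comm hS hw x z]; linarith

/-- A left invariant, proper, `δ`-hyperbolic and roughly geodesic distance on a group. -/
structure IsHypMetric (d : G → G → ℝ) (δ : ℝ) : Prop where
  δ_pos : 0 < δ
  self : ∀ x, d x x = 0
  comm : ∀ x y, d x y = d y x
  triangle : ∀ x y z, d x z ≤ d x y + d y z
  mul_left : ∀ g x y, d (g * x) (g * y) = d x y
  finite_ball : ∀ R, {x | d 1 x ≤ R}.Finite
  four_point : ∀ x y z p, d x y + d z p ≤ d x z + d y p + 2 * δ ∨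
    d x y + d z p ≤ d x p + d y z + 2 * δ
  between : ∀ x y R, 0 ≤ R → R ≤ d x y →
    ∃ z, d x z + d z y = d x y ∧ R - 1 ≤ d x z ∧ d x z ≤ R

theorem isWeight_one : IsWeight (fun _ : S => (1 : ℝ)) := ⟨fun _ => one_pos, fun _ _ _ => rfl⟩

theorem IsHyperbolicGroup.exists_isHypMetric (hG : IsHyperbolicGroup G) :
    ∃ (d : G → G → ℝ) (δ : ℝ), IsHypMetric d δ := by
  obtain ⟨T, hT, δ, hδ, h⟩ := hG
  refine ⟨wordDist T, δ, hδ, weightedDist_self hT isWeight_one,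
    weightedDist_comm hT isWeight_one, weightedDist_triangle hT isWeight_one,
    weightedDist_mul_left _, fun R => ?_, fun x y z p => ?_,
    exists_between hT isWeight_one zero_le_one fun _ => le_rfl⟩
  · refine (finite_weightedBall hT isWeight_one R).subset fun x hx => ?_
    exact (weightedDist_comm hT isWeight_one x 1).trans_le hx
  · have := h x y z p
    unfold gromovProduct at this
    -- In either case the base point terms cancel, leaving the symmetric inequality between sums of
    -- opposite sides.
    rcases min_cases ((wordDist T x p + wordDist T z p - wordDist T x z) / 2)
      ((wordDist T y p + wordDist T z p - wordDist T y z) / 2) with h | h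
    · left; linarith
    · right; linarith

end Metric

end WeightedWord

namespace WeightedWord

/-! ### Hyperbolic geometry and loxodromic elements -/

section Hyperbolic

variable {G : Type*} [Group G] {d : G → G → ℝ} {δ : ℝ}

namespace IsHypMetric

theorem nonneg (H : IsHypMetric d δ) (x y : G) : 0 ≤ d x y := by
  have h₁ := H.triangle x y x
  have h₂ := H.comm x y
  have h₃ := H.self x
  linarith

theorem dist_one_inv (H : IsHypMetric d δ) (x : G) : d 1 x⁻¹ = d 1 x := by
  have h := H.mul_left x 1 x⁻¹
  rw [mul_one, mul_inv_cancel, H.comm] at h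
  exact h.symm

theorem dist_mul_right (H : IsHypMetric d δ) (x y : G) : d x (x * y) = d 1 y := by
  simpa using H.mul_left x 1 y

theorem dist_one_mul_le (H : IsHypMetric d δ) (x y : G) : d 1 (x * y) ≤ d 1 x + d 1 y := by
  have h := H.triangle 1 x (x * y)
  rwa [H.dist_mul_right] at h

theorem dist_one_pow_le (H : IsHypMetric d δ) (x : G) (n : ℕ) : d 1 (x ^ n) ≤ n * d 1 x := by
  induction n with
  | zero => simp [H.self]
  | succ n ih =>
    have h := H.dist_one_mul_le (x ^ n) x
    rw [pow_succ]
    push_cast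
    linarith

/-- Two points close to a geodesic are as close as their distances to an end point are. -/
theorem dist_le_of_excess (H : IsHypMetric d δ) {a b x y : G} {e r : ℝ}
    (hx : d a x + d x b ≤ d a b + e) (hy : d a y + d y b ≤ d a b + e)
    (hr : |d a x - d a y| ≤ r) : d x y ≤ r + e + 2 * δ := by
  have h₁ := H.comm a x
  have h₂ := H.comm a y
  have h₃ := abs_le.1 hr
  rcases H.four_point x y a b with h | h <;> linarith

/-- In the four point condition for `a, b, a', g`, the alternative containing `d a a'` would put `g`
within `D + e + 2 * δ` of `a`; the other one is the claim. -/
theorem excess_replace (H : IsHypMetric d δ) {a a' b g : G} {D e : ℝ}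
    (hg : d a g + d g b ≤ d a b + e) (ha : d a a' ≤ D) (hD : D + e + 2 * δ < d a g) :
    d a' g + d g b ≤ d a' b + (e + 2 * δ) := by
  have h₁ := H.comm b g
  have h₂ := H.comm b a'
  have h₃ := H.nonneg a' g
  rcases H.four_point a b a' g with h | h <;> linarith

/-- Moving the end points of a geodesic does not affect points far from them. -/
theorem excess_replace_both (H : IsHypMetric d δ) {a a' b b' g : G} {D e : ℝ}
    (hg : d a g + d g b ≤ d a b + e) (ha : d a a' ≤ D) (hb : d b b' ≤ D)
    (hag : D + e + 4 * δ < d a g) (hgb : D + e + 4 * δ < d g b) :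
    d a' g + d g b' ≤ d a' b' + (e + 4 * δ) := by
  have hδ := H.δ_pos
  have h₁ := H.excess_replace hg ha (by linarith)
  have h₂ := H.excess_replace (a := b) (a' := b') (b := a') (g := g) (D := D) (e := e + 2 * δ)
    (by rw [H.comm b g, H.comm g a', H.comm b a']; linarith) hb
    (by rw [H.comm b g]; linarith)
  rw [H.comm b' g, H.comm g a', H.comm b' a'] at h₂
  linarith

/-- An isometry almost preserving a geodesic either moves its middle points by a small amount or
translates along it. -/
theorem displacement_dichotomy (H : IsHypMetric d δ) {u x P : G} {D : ℝ} (hcomm : Commute u P)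
    (hx : d 1 x + d x P = d 1 P) (hu : d 1 u ≤ D) (huu : d 1 (u * u) ≤ D)
    (h1x : 2 * D + 10 * δ < d 1 x) (hxP : 2 * D + 10 * δ < d x P) :
    d x (u * x) ≤ 8 * δ ∨ 2 * d x (u * x) ≤ d x (u * (u * x)) + 12 * δ := by
  have hδ := H.δ_pos
  have hD : 0 ≤ D := (H.nonneg _ _).trans hu
  -- Since `v * P = P * v`, translation by `v` moves both ends of the geodesic from `1` to `P` by `d
  -- 1 v`, so `v * x` is still nearly on it.
  have key : ∀ v : G, Commute v P → d 1 v ≤ D →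
      d 1 (v * x) + d (v * x) P ≤ d 1 P + 4 * δ := by
    intro v hv hvD
    have e₁ : d v (v * x) = d 1 x := H.dist_mul_right v x
    have e₂ : d (v * x) (v * P) = d x P := H.mul_left v x P
    have e₃ : d v (v * P) = d 1 P := H.dist_mul_right v P
    have e₄ : d (v * P) P = d 1 v := by rw [hv.eq, H.comm, H.dist_mul_right]
    have h := H.excess_replace_both (a := v) (a' := 1) (b := v * P) (b' := P) (g := v * x)
      (D := D) (e := 0) (by linarith) (by rw [H.comm]; exact hvD) (by linarith) (by linarith)
      (by linarith)
    linarith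
  have k₀ : d 1 x + d x P ≤ d 1 P + 4 * δ := by linarith
  have k₁ := key u hcomm hu
  have k₂ := key (u * u) (hcomm.mul_left hcomm) huu
  rw [mul_assoc] at k₂
  set x₁ := u * x with hx₁
  set x₂ := u * x₁ with hx₂
  have f₀ : d x x₁ ≤ |d 1 x - d 1 x₁| + 4 * δ + 2 * δ := H.dist_le_of_excess k₀ k₁ le_rfl
  have f₁ : d x₁ x₂ ≤ |d 1 x₁ - d 1 x₂| + 4 * δ + 2 * δ := H.dist_le_of_excess k₁ k₂ le_rfl
  have e₁ : d x₁ x₂ = d x x₁ := H.mul_left u x x₁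
  have e₂ : d u x₁ = d 1 x := H.dist_mul_right u x
  have e₃ : d u x₂ = d 1 x₁ := by
    have := H.mul_left u 1 x₁
    rwa [mul_one] at this
  have b₀ : d 1 x₁ ≤ d 1 u + d 1 x := H.dist_one_mul_le u x
  have b₁ : d 1 x ≤ d 1 x₁ + d 1 u := by
    have h := H.triangle u 1 x₁
    rw [H.comm u 1] at h
    linarith
  have b₂ : d 1 x ≤ d 1 x₂ + D := by
    have h := H.triangle (u * u) 1 x₂
    rw [H.comm (u * u) 1] at h
    have h' : d (u * u) x₂ = d 1 x := by
      rw [hx₂, hx₁, ← mul_assoc]; exact H.dist_mul_right _ _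
    linarith
  have g₀ : |d 1 x - d 1 x₁| ≤ D := abs_le.2 ⟨by linarith, by linarith⟩
  have n₁ := H.comm u 1
  have n₂ := H.comm x₁ 1
  have n₃ := H.comm x₂ 1
  have n₄ := H.comm x₂ x₁
  have n₅ := H.comm x₁ u
  have n₆ := H.comm x₂ u
  -- The distances of `x, x₁, x₂` from `1` nearly form an arithmetic progression. If they are
  -- monotone, the two steps add up; if they turn back, both steps are short.
  have q₁ : d 1 x₂ + d 1 x ≤ 2 * d 1 x₁ + 2 * δ := by
    rcases H.four_point 1 x₂ x₁ u with h | h <;> linarith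
  have q₂ : 2 * d 1 x₁ ≤ d 1 x₂ + d 1 x + 2 * δ := by
    rcases H.four_point 1 x₁ x₂ u with h | h <;> linarith
  have m₁ := H.triangle 1 x x₂
  have m₂ := H.triangle 1 x₂ x
  rw [H.comm x₂ x] at m₂
  rcases le_total (d 1 x) (d 1 x₁) with h | h <;> rcases le_total (d 1 x₁) (d 1 x₂) with h' | h' <;>
    [rw [abs_of_nonpos (by linarith)] at f₀; rw [abs_of_nonpos (by linarith)] at f₀;
      rw [abs_of_nonneg (by linarith)] at f₀; rw [abs_of_nonneg (by linarith)] at f₀] <;>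
    [rw [abs_of_nonpos (by linarith)] at f₁; rw [abs_of_nonneg (by linarith)] at f₁;
      rw [abs_of_nonpos (by linarith)] at f₁; rw [abs_of_nonneg (by linarith)] at f₁]
  · right; linarith
  · left; linarith
  · left; linarith
  · right; linarith

end IsHypMetric

/-- The powers of `h` form a quasi-geodesic. -/
structure IsLoxodromic (d : G → G → ℝ) (h : G) (e : ℝ) : Prop where
  le_dist : ∀ n : ℕ, (n : ℝ) ≤ d 1 (h ^ n)
  excess : ∀ m n : ℕ, d 1 (h ^ m) + d 1 (h ^ n) ≤ d 1 (h ^ (m + n)) + e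

theorem IsHypMetric.dist_pow_pow (H : IsHypMetric d δ) (h : G) (m n : ℕ) :
    d (h ^ m) (h ^ (m + n)) = d 1 (h ^ n) := by
  rw [pow_add, H.dist_mul_right]

/-- Local-to-global: when one step is long compared with the defect `a` at a corner, the four point
condition at successive powers excludes backtracking, so defects do not accumulate. -/
theorem IsHypMetric.isLoxodromic (H : IsHypMetric d δ) {h : G} {a : ℝ}
    (h₂ : 2 * d 1 h ≤ d 1 (h * h) + 2 * a) (h₁ : 2 * a + 3 * δ + 1 < d 1 h) :
    IsLoxodromic d h (2 * a + 4 * δ) := by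
  have hδ := H.δ_pos
  have step : ∀ n : ℕ, d 1 (h ^ n) + d 1 h ≤ d 1 (h ^ (n + 1)) + (2 * a + 2 * δ) := by
    intro n
    induction n with
    | zero =>
      have := H.triangle h 1 (h * h)
      have e₁ := H.dist_mul_right h h
      have e₂ := H.comm h 1
      have e₃ := H.dist_one_mul_le h h
      simp only [pow_zero, H.self, zero_add, pow_one]
      linarith
    | succ n ih =>
      have e₁ := H.dist_pow_pow h n 2
      have e₂ := H.dist_pow_pow h n 1
      have e₃ := H.dist_pow_pow h (n + 1) 1
      rw [pow_two] at e₁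
      rw [pow_one] at e₂ e₃
      have c₁ := H.comm (h ^ n) 1
      have c₂ := H.comm (h ^ (n + 2)) 1
      have c₃ := H.comm (h ^ (n + 2)) (h ^ (n + 1))
      rw [add_assoc] at e₃ ⊢
      norm_num at e₃ ⊢
      rcases H.four_point (h ^ n) (h ^ (n + 2)) 1 (h ^ (n + 1)) with q | q <;> linarith
  refine ⟨fun n => ?_, fun m n => ?_⟩
  · induction n with
    | zero => simp [H.self]
    | succ n ih =>
      have := step n
      push_cast
      linarith
  · cases n with
    | zero => simp only [pow_zero, H.self, add_zero]
              have := H.dist_one_mul_le h h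
              linarith
    | succ n =>
      have s₁ := step m
      have s₂ := step n
      have e₁ := H.dist_pow_pow h m (n + 1)
      have e₂ := H.dist_pow_pow h m 1
      have e₃ := H.dist_pow_pow h (m + 1) n
      rw [pow_one] at e₂
      rw [add_assoc, add_comm 1 n] at e₃
      have c₁ := H.comm (h ^ (m + (n + 1))) (h ^ m)
      have c₂ := H.comm (h ^ (m + 1)) (h ^ m)
      rcases H.four_point 1 (h ^ (m + 1)) (h ^ (m + (n + 1))) (h ^ m) with q | q <;> linarith

theorem IsHypMetric.exists_lt_dist_pow (H : IsHypMetric d δ) {s : G} (hs : ¬ IsOfFinOrder s)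
    (R : ℝ) : ∃ m : ℕ, R < d 1 (s ^ m) := by
  by_contra! h
  refine Set.infinite_range_of_injective (injective_pow_iff_not_isOfFinOrder.2 hs)
    ((H.finite_ball R).subset ?_)
  rintro _ ⟨m, rfl⟩
  exact h m

/-- Elements of infinite order have loxodromic powers. -/
theorem IsHypMetric.exists_isLoxodromic (H : IsHypMetric d δ) {s : G} (hs : ¬ IsOfFinOrder s) :
    ∃ (x h : G) (i : ℕ), 0 < i ∧ s ^ i = x * h * x⁻¹ ∧ IsLoxodromic d h (16 * δ) := by
  have hδ := H.δ_pos
  -- With `a = 6 * δ` below, `15 * δ + 1` is the step length that `isLoxodromic` requires. By left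
  -- invariance the pigeonhole bound `N` does not depend on `x`, so `m` can be chosen after it,
  -- large enough to place `x` deep inside the geodesic.
  set F := H.finite_ball (15 * δ + 1) with hF
  set N := F.toFinset.card + 1 with hN
  set D : ℝ := 2 * N * d 1 s with hD
  obtain ⟨m, hm⟩ := H.exists_lt_dist_pow hs (2 * (2 * D + 10 * δ + 2))
  have hD0 : 0 ≤ D := mul_nonneg (by positivity) (H.nonneg _ _)
  obtain ⟨x, hx, hx₁, hx₂⟩ := H.between 1 (s ^ m) (d 1 (s ^ m) / 2) (by linarith) (by linarith)
  obtain ⟨i, hi, hiN, hiK⟩ : ∃ i : ℕ, 0 < i ∧ i ≤ N ∧ 15 * δ + 1 < d x (s ^ i * x) := by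
    by_contra! hcon
    have hmaps : ∀ i ∈ Finset.range N, x⁻¹ * s ^ (i + 1) * x ∈ F.toFinset := by
      intro i hi
      have hi' := Finset.mem_range.1 hi
      rw [Set.Finite.mem_toFinset, Set.mem_ofPred_eq, ← H.dist_mul_right x]
      simpa [mul_assoc] using hcon (i + 1) (by omega) (by omega)
    have hinj : Set.InjOn (fun i : ℕ => x⁻¹ * s ^ (i + 1) * x) (Finset.range N : Set ℕ) := by
      intro i _ j _ hij
      have : s ^ (i + 1) = s ^ (j + 1) := by simpa using hij
      have := injective_pow_iff_not_isOfFinOrder.2 hs this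
      omega
    have := Finset.card_le_card_of_injOn _ hmaps hinj
    rw [Finset.card_range] at this
    omega
  have hle : ∀ j : ℕ, j ≤ 2 * N → d 1 (s ^ j) ≤ D := by
    intro j hj
    refine (H.dist_one_pow_le s j).trans ?_
    rw [hD]
    have : (j : ℝ) ≤ 2 * N := by exact_mod_cast hj
    exact mul_le_mul_of_nonneg_right this (H.nonneg _ _)
  have hdich := H.displacement_dichotomy (u := s ^ i) (x := x) (P := s ^ m) (D := D)
    (Commute.pow_pow_self s i m) hx (hle i (by omega))
    (by rw [← pow_add]; exact hle _ (by omega)) (by linarith) (by linarith)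
  refine ⟨x, x⁻¹ * s ^ i * x, i, hi, by group, ?_⟩
  have e₁ : d 1 (x⁻¹ * s ^ i * x) = d x (s ^ i * x) := by
    rw [← H.dist_mul_right x]; simp [mul_assoc]
  have e₂ : d 1 (x⁻¹ * s ^ i * x * (x⁻¹ * s ^ i * x)) = d x (s ^ i * (s ^ i * x)) := by
    rw [← H.dist_mul_right x]; simp [mul_assoc]
  have := H.isLoxodromic (h := x⁻¹ * s ^ i * x) (a := 6 * δ)
    (by rw [e₁, e₂]; rcases hdich with h | h <;> linarith) (by rw [e₁]; linarith)
  convert this using 1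
  ring

/-! ### Ends of loxodromic elements and ping-pong -/

namespace IsLoxodromic

variable {h : G} {e : ℝ}

theorem excess_nonneg (H : IsHypMetric d δ) (L : IsLoxodromic d h e) : 0 ≤ e := by
  have := L.excess 0 0
  simp only [pow_zero, H.self, add_zero] at this
  linarith

theorem inv (H : IsHypMetric d δ) (L : IsLoxodromic d h e) : IsLoxodromic d h⁻¹ e := by
  refine ⟨fun n => ?_, fun m n => ?_⟩
  · rw [inv_pow, H.dist_one_inv]; exact L.le_dist n
  · simp only [inv_pow, H.dist_one_inv]; exact L.excess m n

theorem excess_dist (H : IsHypMetric d δ) (L : IsLoxodromic d h e) {j m : ℕ} (hj : j ≤ m) :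
    d 1 (h ^ j) + d (h ^ j) (h ^ m) ≤ d 1 (h ^ m) + e := by
  obtain ⟨k, rfl⟩ := Nat.exists_eq_add_of_le hj
  rw [H.dist_pow_pow]
  exact L.excess j k

/-- A point close to a geodesic between powers of `h` is close to a power of `h`. -/
theorem exists_dist_pow_le (H : IsHypMetric d δ) (L : IsLoxodromic d h e) {e' : ℝ} (he : e ≤ e')
    {y : G} {M : ℕ} (hy : d 1 y + d y (h ^ M) ≤ d 1 (h ^ M) + e') :
    ∃ j : ℕ, d (h ^ j) y ≤ d 1 h + e' + e' + 2 * δ := by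
  have h0 := L.excess_nonneg H
  have h1 := H.nonneg 1 h
  obtain ⟨j, hjM, hj⟩ : ∃ j ≤ M, |d 1 (h ^ j) - d 1 y| ≤ d 1 h + e' := by
    rcases le_total (d 1 (h ^ M)) (d 1 y) with hM | hM
    · have := H.nonneg y (h ^ M)
      exact ⟨M, le_rfl, abs_le.2 ⟨by linarith, by linarith⟩⟩
    · classical
      have hex : ∃ j, d 1 y ≤ d 1 (h ^ j) := ⟨M, hM⟩
      have hle : Nat.find hex ≤ M := Nat.find_min' hex hM
      have hs := Nat.find_spec hex
      refine ⟨Nat.find hex, hle, ?_⟩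
      rcases hk : Nat.find hex with _ | k
      · rw [hk, pow_zero, H.self] at hs
        have := H.nonneg 1 y
        rw [pow_zero, H.self]
        exact abs_le.2 ⟨by linarith, by linarith⟩
      · have hlt := Nat.find_min hex (m := k) (by omega)
        rw [hk] at hs
        have := H.dist_one_mul_le (h ^ k) h
        rw [← pow_succ] at this
        exact abs_le.2 ⟨by linarith, by linarith⟩
  refine ⟨j, H.dist_le_of_excess (a := 1) (b := h ^ M) ?_ hy hj⟩
  have := L.excess_dist H hjM
  linarith

/-- If the rays of powers of `u` and of translated powers of `h` have unbounded Gromov products,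
then they stay close. -/
theorem dist_pow_mul_pow_le (H : IsHypMetric d δ) (L : IsLoxodromic d h e) {u : G}
    (Lu : IsLoxodromic d u e) (huh : ∀ n : ℕ, d 1 (u ^ n) = d 1 (h ^ n)) {g : G}
    (hg : ∀ X : ℝ, ∃ n m : ℕ, X < d 1 (u ^ n) + d 1 (g * h ^ m) - d (u ^ n) (g * h ^ m)) (k : ℕ) :
    d (u ^ k) (g * h ^ k) ≤ d 1 g + (e + 2 * δ + 2 * d 1 g) + 2 * δ := by
  have hδ := H.δ_pos
  have h0 := L.excess_nonneg H
  have h1 := H.nonneg 1 h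
  have hD := H.nonneg 1 g
  have hkh : 0 ≤ k * d 1 h := by positivity
  -- This size forces `n, m ≥ k` and rules out the four point alternative in which the two rays have
  -- separated before `u ^ k`.
  obtain ⟨n, m, hnm⟩ := hg (2 * (k * d 1 h) + 2 * d 1 g + 2 * δ)
  have t₁ := H.triangle 1 (u ^ n) (g * h ^ m)
  have t₂ := H.triangle 1 (g * h ^ m) (u ^ n)
  rw [H.comm (g * h ^ m) (u ^ n)] at t₂
  have pw : ∀ j : ℕ, k * d 1 h < d 1 (h ^ j) → k ≤ j := by
    intro j hj
    by_contra! hlt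
    have h₁ := H.dist_one_pow_le h j
    have h₂ : (j : ℝ) * d 1 h ≤ k * d 1 h :=
      mul_le_mul_of_nonneg_right (by exact_mod_cast hlt.le) h1
    linarith
  have hn : k ≤ n := pw n (by rw [← huh]; linarith)
  have hm : k ≤ m := pw m (by linarith [H.dist_one_mul_le g (h ^ m)])
  have hx := Lu.excess_dist H hn
  have hy := L.excess_dist H hm
  have hxk : d 1 (u ^ k) ≤ k * d 1 h := by rw [huh]; exact H.dist_one_pow_le h k
  have y₁ : d g (g * h ^ k) = d 1 (h ^ k) := H.dist_mul_right _ _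
  have y₂ : d (g * h ^ k) (g * h ^ m) = d (h ^ k) (h ^ m) := H.mul_left _ _ _
  have y₃ : d g (g * h ^ m) = d 1 (h ^ m) := H.dist_mul_right _ _
  have y₄ := H.triangle 1 g (g * h ^ k)
  have y₅ := H.triangle g 1 (g * h ^ k)
  have y₆ := H.triangle g 1 (g * h ^ m)
  have c₁ := H.comm g 1
  have hkk := huh k
  refine H.dist_le_of_excess (a := 1) (b := g * h ^ m) ?_ (by linarith)
    (abs_le.2 ⟨by linarith, by linarith⟩)
  have t₃ := H.triangle 1 (u ^ k) (g * h ^ m)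
  have c₂ := H.comm (g * h ^ m) (u ^ k)
  have c₃ := H.comm (u ^ n) (u ^ k)
  rcases H.four_point 1 (u ^ n) (g * h ^ m) (u ^ k) with q | q <;> linarith

/-- Pigeonhole: the elements `(u ^ k)⁻¹ * (g * h ^ k)` lie in a finite ball, so two of them
coincide, and cancelling gives the relation. -/
theorem exists_semiconjBy (H : IsHypMetric d δ) {u g : G} {K : ℝ}
    (hK : ∀ k : ℕ, d (u ^ k) (g * h ^ k) ≤ K) : ∃ p : ℕ, 0 < p ∧ SemiconjBy g (h ^ p) (u ^ p) := by
  have hmem : ∀ k : ℕ, (u ^ k)⁻¹ * (g * h ^ k) ∈ {x | d 1 x ≤ K} := by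
    intro k
    rw [Set.mem_ofPred_eq, ← H.dist_mul_right (u ^ k), mul_inv_cancel_left]
    exact hK k
  have := (H.finite_ball K).to_subtype
  obtain ⟨i, j, hne, heq⟩ := Finite.exists_ne_map_eq_of_infinite
    (fun k : ℕ => (⟨_, hmem k⟩ : {x | d 1 x ≤ K}))
  have hij : (u ^ i)⁻¹ * (g * h ^ i) = (u ^ j)⁻¹ * (g * h ^ j) := congrArg Subtype.val heq
  clear heq
  wlog hlt : i < j generalizing i j
  · exact this j i hne.symm hij.symm (by omega)
  obtain ⟨p, rfl⟩ := Nat.exists_eq_add_of_lt hlt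
  refine ⟨p + 1, by omega, ?_⟩
  rw [add_assoc, pow_add u, add_comm i, pow_add h, mul_inv_rev, mul_assoc, ← mul_assoc g,
    inv_mul_eq_iff_eq_mul, eq_comm] at hij
  have h3 : u ^ i * ((u ^ (p + 1))⁻¹ * ((u ^ i)⁻¹ * (g * h ^ (p + 1) * h ^ i)))
      = (u ^ (p + 1))⁻¹ * (g * h ^ (p + 1)) * h ^ i := by
    have : Commute (u ^ i) (u ^ (p + 1))⁻¹ := (Commute.pow_pow_self u i (p + 1)).inv_right
    rw [← mul_assoc, this.eq]
    group
  rw [h3] at hij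
  have h4 := mul_right_cancel hij
  rwa [inv_mul_eq_iff_eq_mul] at h4

/-- An element that conjugates a power of `h` to a power of `u` is near the powers of `u`. -/
theorem exists_dist_zpow_le (H : IsHypMetric d δ) (L : IsLoxodromic d h e) {u : G}
    (Lu : IsLoxodromic d u e) {g : G} {p : ℕ} (hp : 0 < p) (hg : SemiconjBy g (h ^ p) (u ^ p)) :
    ∃ j : ℤ, d (u ^ j) g ≤ d 1 u + (e + 4 * δ) + (e + 4 * δ) + 2 * δ := by
  have hδ := H.δ_pos
  obtain ⟨n, hn⟩ := exists_nat_gt (d 1 g + e + 4 * δ)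
  set M := p * n with hM
  have hnM : (n : ℝ) ≤ d 1 (h ^ M) := by
    refine le_trans ?_ (L.le_dist M)
    exact_mod_cast Nat.le_mul_of_pos_left n hp
  have hgM : g * h ^ M = u ^ M * g := by
    have := hg.pow_right n
    rw [← pow_mul, ← pow_mul] at this
    exact this
  have hgM' : g * (h ^ M)⁻¹ = (u ^ M)⁻¹ * g := by
    rw [mul_inv_eq_iff_eq_mul, mul_assoc, hgM, inv_mul_cancel_left]
  have e₁ : d (g * (h ^ M)⁻¹) g = d 1 (h ^ M) := by
    rw [H.comm, H.dist_mul_right, H.dist_one_inv]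
  have e₂ : d g (g * h ^ M) = d 1 (h ^ M) := H.dist_mul_right _ _
  have e₃ : d (g * (h ^ M)⁻¹) (g * h ^ M) = d 1 (h ^ (M + M)) := by
    rw [H.mul_left, ← H.mul_left (h ^ M), mul_inv_cancel, pow_add]
  have hL := L.excess M M
  -- `g` lies nearly between `g * h ^ (±M) = u ^ (±M) * g`, whose distance to `u ^ (±M)` is `d 1 g`.
  -- As `M` is large compared with `d 1 g`, the resulting bound does not depend on `g`.
  have r := H.excess_replace_both (a := g * (h ^ M)⁻¹) (a' := (u ^ M)⁻¹) (b := g * h ^ M)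
    (b' := u ^ M) (g := g) (D := d 1 g) (e := e) (by linarith)
    (by rw [hgM', H.comm, H.dist_mul_right]) (by rw [hgM, H.comm, H.dist_mul_right])
    (by linarith) (by linarith)
  rw [← H.mul_left (u ^ M), ← H.mul_left (u ^ M) g, ← H.mul_left (u ^ M) (u ^ M)⁻¹ (u ^ M),
    mul_inv_cancel, ← pow_add] at r
  obtain ⟨j, hj⟩ := Lu.exists_dist_pow_le H (by linarith) r
  refine ⟨(j : ℤ) - M, ?_⟩
  rw [← H.mul_left (u ^ M), ← zpow_natCast u M, ← zpow_add, add_sub_cancel, zpow_natCast,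
    zpow_natCast]
  exact hj

theorem not_isOfFinOrder (H : IsHypMetric d δ) (L : IsLoxodromic d h e) : ¬ IsOfFinOrder h := by
  rw [isOfFinOrder_iff_pow_eq_one]
  rintro ⟨n, hn, hn1⟩
  have := L.le_dist n
  rw [hn1, H.self] at this
  have : (0 : ℝ) < n := by exact_mod_cast hn
  linarith

/-- If all elements are near the powers of `h`, then the group is virtually cyclic. -/
theorem not_isNonElementary (H : IsHypMetric d δ) (L : IsLoxodromic d h e) {K : ℝ}
    (hK : ∀ g : G, ∃ j : ℤ, d (h ^ j) g ≤ K) : ¬ IsNonElementary G := by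
  refine fun hne => hne.2 ⟨(zpowersHom G h).range, ?_, ⟨(MonoidHom.ofInjective ?_).symm⟩⟩
  · have hfin : Finite (G ⧸ (zpowersHom G h).range) := by
      refine Set.finite_univ_iff.1 (((H.finite_ball K).image
        fun u => (QuotientGroup.mk u⁻¹ : G ⧸ (zpowersHom G h).range)).subset ?_)
      intro q _
      obtain ⟨g, rfl⟩ := QuotientGroup.mk_surjective q
      obtain ⟨j, hj⟩ := hK g⁻¹
      refine ⟨(h ^ j)⁻¹ * g⁻¹, ?_, ?_⟩
      · rw [Set.mem_ofPred_eq, ← H.dist_mul_right (h ^ j), mul_inv_cancel_left]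
        exact hj
      · rw [QuotientGroup.eq]
        exact ⟨Multiplicative.ofAdd (-j), by simp⟩
    exact Subgroup.finiteIndex_of_finite_quotient
  · intro a b hab
    have := injective_zpow_iff_not_isOfFinOrder.2 (L.not_isOfFinOrder H)
    exact Multiplicative.toAdd.injective (this (by simpa [zpowersHom_apply] using hab))

/-- In a non-elementary group, some `g` moves the forward end of `h` off both ends of `h`. -/
theorem exists_gromovProduct_le (H : IsHypMetric d δ) (L : IsLoxodromic d h e)
    (hne : IsNonElementary G) : ∃ (g : G) (A : ℝ), ∀ (n : ℤ) (m : ℕ),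
      d 1 (h ^ n) + d 1 (g * h ^ m) - d (h ^ n) (g * h ^ m) ≤ A := by
  by_contra! hcon
  refine L.not_isNonElementary H (K := d 1 h + (e + 4 * δ) + (e + 4 * δ) + 2 * δ)
    (fun g => ?_) hne
  by_cases hp : ∀ X : ℝ, ∃ n m : ℕ, X < d 1 (h ^ n) + d 1 (g * h ^ m) - d (h ^ n) (g * h ^ m)
  · obtain ⟨p, hp0, hp⟩ := exists_semiconjBy H (L.dist_pow_mul_pow_le H L (fun _ => rfl) hp)
    exact L.exists_dist_zpow_le H L hp0 hp
  · have Li := L.inv H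
    have hn : ∀ X : ℝ, ∃ n m : ℕ,
        X < d 1 (h⁻¹ ^ n) + d 1 (g * h ^ m) - d (h⁻¹ ^ n) (g * h ^ m) := by
      push Not at hp
      obtain ⟨X₀, hX₀⟩ := hp
      -- Nonnegative exponents contribute at most `X₀`, so a value above `max X X₀` comes from a
      -- negative one.
      intro X
      obtain ⟨n, m, hnm⟩ := hcon g (max X X₀)
      obtain ⟨n, rfl | rfl⟩ := n.eq_nat_or_neg
      · have := hX₀ n m
        rw [zpow_natCast] at hnm
        exact absurd ((le_max_right X X₀).trans_lt hnm) this.not_gt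
      · refine ⟨n, m, (le_max_left X X₀).trans_lt ?_⟩
        rwa [zpow_neg, zpow_natCast, ← inv_pow] at hnm
    obtain ⟨p, hp0, hp⟩ := exists_semiconjBy H
      (L.dist_pow_mul_pow_le H Li (fun n => by rw [inv_pow, H.dist_one_inv]) hn)
    obtain ⟨j, hj⟩ := L.exists_dist_zpow_le H Li hp0 hp
    exact ⟨-j, by rwa [H.dist_one_inv, inv_zpow'] at hj⟩

end IsLoxodromic

/-- Ping-pong for semigroups. -/
theorem prod_injective_of_pingPong {a : ℕ → G} {Y : Set G} (h1 : (1 : G) ∈ Y)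
    (hY : ∀ k, ∀ y ∈ Y, a k * y ∈ Y)
    (hdisj : ∀ k k', k < k' → ∀ y ∈ Y, ∀ y' ∈ Y, a k * y ≠ a k' * y') (l l' : List ℕ)
    (hlen : l.length = l'.length) (hprod : (l.map a).prod = (l'.map a).prod) : l = l' := by
  have hmem : ∀ l : List ℕ, (l.map a).prod ∈ Y := by
    intro l
    induction l with
    | nil => simpa using h1
    | cons k l ih => rw [List.map_cons, List.prod_cons]; exact hY k _ ih
  induction l generalizing l' with
  | nil => exact (List.length_eq_zero_iff.1 hlen.symm).symm
  | cons k l ih =>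
    rcases l' with _ | ⟨k', l'⟩
    · simp at hlen
    · rw [List.map_cons, List.prod_cons, List.map_cons, List.prod_cons] at hprod
      rcases lt_trichotomy k k' with h | rfl | h
      · exact absurd hprod (hdisj k k' h _ (hmem l) _ (hmem l'))
      · rw [ih l' (by simpa using hlen) (mul_left_cancel hprod)]
      · exact absurd hprod.symm (hdisj k' k h _ (hmem l') _ (hmem l))

/-- The ping-pong set `Y` consists of the points away from both ends of `h`. A power `h ^ (q * (k +
1))` pushes `Y` towards the forward end, and `g` moves that end back into `Y`. A collision between
two exponents would put a point of `Y` near the forward end. -/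
theorem IsLoxodromic.exists_prod_injective {h : G} {e : ℝ} (H : IsHypMetric d δ)
    (L : IsLoxodromic d h e) (hne : IsNonElementary G) :
    ∃ (g : G) (q : ℕ), 0 < q ∧ ∀ l l' : List ℕ, l.length = l'.length →
      (l.map fun k => g * h ^ (q * (k + 1))).prod = (l'.map fun k => g * h ^ (q * (k + 1))).prod →
      l = l' := by
  have hδ := H.δ_pos
  obtain ⟨g, A, hA⟩ := L.exists_gromovProduct_le H hne
  have hA0 : 0 ≤ A := by
    have := hA 0 0
    simpa [H.self] using this
  have hD := H.nonneg 1 g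
  obtain ⟨q, hq⟩ := exists_nat_gt (A + 2 * δ + d 1 g + 1)
  have hq0 : 0 < q := by
    have : (0 : ℝ) < q := by linarith
    exact_mod_cast this
  set Y : Set G := {y | ∀ n : ℤ, d 1 (h ^ n) + d 1 y - d (h ^ n) y ≤ A + 2 * δ} with hY
  have hX : ∀ k : ℕ, ∀ y ∈ Y, A + 2 * δ + 2 * d 1 g <
      d 1 (h ^ (q * (k + 1))) + d 1 (h ^ (q * (k + 1)) * y) -
        d (h ^ (q * (k + 1))) (h ^ (q * (k + 1)) * y) := by
    intro k y hy
    have h₁ := hy (-(q * (k + 1) : ℕ))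
    rw [zpow_neg, zpow_natCast, H.dist_one_inv, 
      ← H.mul_left (h ^ (q * (k + 1))) (h ^ (q * (k + 1)))⁻¹ y, mul_inv_cancel] at h₁
    have h₂ := L.le_dist (q * (k + 1))
    have h₃ : (q : ℝ) ≤ (q * (k + 1) : ℕ) := by
      exact_mod_cast Nat.le_mul_of_pos_right q (Nat.succ_pos k)
    rw [H.dist_mul_right]
    linarith
  refine ⟨g, q, hq0, prod_injective_of_pingPong (Y := Y) ?_ ?_ ?_⟩
  · intro n
    rw [H.self, H.comm]
    linarith
  · intro k y hy n
    have h₁ := hX k y hy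
    set z := h ^ (q * (k + 1)) * y
    rw [mul_assoc]
    change d 1 (h ^ n) + d 1 (g * z) - d (h ^ n) (g * z) ≤ A + 2 * δ
    have h₂ := hA n (q * (k + 1))
    set v := h ^ (q * (k + 1))
    have e₁ : d (g * v) (g * z) = d v z := H.mul_left g v z
    have e₂ := H.triangle g 1 (g * v)
    have e₃ := H.triangle g 1 (g * z)
    rw [H.comm g 1, H.dist_mul_right] at e₂ e₃
    have c₁ := H.comm (g * v) 1
    have c₂ := H.comm (h ^ n) 1
    have c₃ := H.comm (g * z) 1
    have c₄ := H.comm (g * z) (g * v)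
    -- `g * v` and `g * z` have a large Gromov product, so `g * z` inherits from `g * v` the bound
    -- `A`, up to `2 * δ`.
    rcases H.four_point (h ^ n) (g * v) (g * z) 1 with r | r <;> linarith
  · intro k k' hk y hy y' hy' heq
    obtain ⟨j, rfl⟩ := Nat.exists_eq_add_of_lt hk
    have h₁ := hX j y' hy'
    have h₂ : y = h ^ (q * (j + 1)) * y' := by
      have : q * (k + j + 1 + 1) = q * (k + 1) + q * (j + 1) := by ring
      rw [this, pow_add, ← mul_assoc g, mul_assoc (g * _)] at heq
      exact mul_left_cancel heq
    have h₃ := hy (q * (j + 1) : ℕ)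
    rw [zpow_natCast, h₂] at h₃
    linarith

/-- In a non-elementary hyperbolic group, any `s` of infinite order has a power that together
with a suitable `b` spans exponentially many products. -/
theorem IsHyperbolicGroup.exists_prod_injective (hG : IsHyperbolicGroup G)
    (hne : IsNonElementary G) {s : G} (hs : ¬ IsOfFinOrder s) :
    ∃ (b : G) (q : ℕ), 0 < q ∧ ∀ l l' : List ℕ, l.length = l'.length →
      (l.map fun k => b * s ^ (q * (k + 1))).prod = (l'.map fun k => b * s ^ (q * (k + 1))).prod →
      l = l' := by
  obtain ⟨d, δ, H⟩ := hG.exists_isHypMetric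
  obtain ⟨x, h, i, hi, hsi, L⟩ := H.exists_isLoxodromic hs
  obtain ⟨g, q, hq, hinj⟩ := L.exists_prod_injective H hne
  have hterm : (fun k : ℕ => x * g * x⁻¹ * s ^ (i * q * (k + 1))) =
      MulAut.conj x ∘ fun k => g * h ^ (q * (k + 1)) := by
    funext k
    have : s ^ i = MulAut.conj x h := by rw [hsi, MulAut.conj_apply]
    rw [mul_assoc i, pow_mul, this, Function.comp_apply, map_mul, map_pow, MulAut.conj_apply x g]
  refine ⟨x * g * x⁻¹, i * q, Nat.mul_pos hi hq, fun l l' hlen heq => hinj l l' hlen ?_⟩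
  rw [hterm, ← List.map_map, ← List.map_map, ← map_list_prod, ← map_list_prod] at heq
  exact (MulAut.conj x).injective heq

end Hyperbolic

end WeightedWord

namespace WeightedWord

/-! ### Volume entropy: existence, semicontinuity, blow-up -/

section Entropy

variable {G : Type*} [Group G] {S : Finset G}

theorem IsWeight.le_sum {w : S → ℝ} (hw : IsWeight w) (s : S) : w s ≤ ∑ t, w t :=
  Finset.single_le_sum (fun t _ => (hw.pos t).le) (Finset.mem_univ s)

theorem IsWeight.sum_univ_nonneg {w : S → ℝ} (hw : IsWeight w) : 0 ≤ ∑ t, w t :=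
  Finset.sum_nonneg fun t _ => (hw.pos t).le

theorem weightedBall_mono (w : S → ℝ) {R R' : ℝ} (h : R ≤ R') :
    weightedBall w R ⊆ weightedBall w R' :=
  fun _ hx => le_trans hx h

theorem ncard_weightedBall_mono (hS : IsSymmGenSet S) {w : S → ℝ} (hw : IsWeight w) {R R' : ℝ}
    (h : R ≤ R') : (weightedBall w R).ncard ≤ (weightedBall w R').ncard :=
  Set.ncard_le_ncard (weightedBall_mono w h) (finite_weightedBall hS hw R')

theorem ncard_weightedBall_pos (hS : IsSymmGenSet S) {w : S → ℝ} (hw : IsWeight w) {R : ℝ}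
    (hR : 0 ≤ R) : 0 < (weightedBall w R).ncard :=
  (Set.ncard_pos (finite_weightedBall hS hw R)).2
    ⟨1, (weightedDist_self hS hw 1).trans_le hR⟩

/-- Cut a geodesic just before length `R`: the shortfall is less than one letter, and the total
weight bounds every letter. -/
theorem ncard_weightedBall_add_le (hS : IsSymmGenSet S) {w : S → ℝ} (hw : IsWeight w) {R R' : ℝ}
    (hR : 0 ≤ R) (hR' : 0 ≤ R') :
    (weightedBall w (R + R')).ncard ≤
      (weightedBall w R).ncard * (weightedBall w (R' + ∑ s, w s)).ncard := by
  rw [← Set.ncard_prod]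
  have hfin := (finite_weightedBall hS hw R).prod (finite_weightedBall hS hw (R' + ∑ s, w s))
  refine (Set.ncard_le_ncard (t := (fun p : G × G => p.1 * p.2) '' _) ?_ (hfin.image _)).trans
    (Set.ncard_image_le hfin)
  intro x hx
  have hx : weightedDist w x 1 ≤ R + R' := hx
  have hc := hw.sum_univ_nonneg
  rcases le_total (weightedDist w x 1) R with h | h
  · exact ⟨(x, 1), ⟨h, (weightedDist_self hS hw 1).trans_le (by linarith)⟩, mul_one x⟩
  · rw [weightedDist_comm hS hw] at h hx
    obtain ⟨z, hz, hz₁, hz₂⟩ := exists_between hS hw hc hw.le_sum 1 x R hR h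
    refine ⟨(z, z⁻¹ * x), ⟨?_, ?_⟩, mul_inv_cancel_left z x⟩
    · exact (weightedDist_comm hS hw z 1).trans_le hz₂
    · change weightedDist w (z⁻¹ * x) 1 ≤ _
      rw [← weightedDist_mul_left w z, mul_inv_cancel_left, mul_one, weightedDist_comm hS hw]
      linarith

theorem log_ncard_weightedBall_mono (hS : IsSymmGenSet S) {w : S → ℝ} (hw : IsWeight w) {R R' : ℝ}
    (hR : 0 ≤ R) (h : R ≤ R') :
    Real.log (weightedBall w R).ncard ≤ Real.log (weightedBall w R').ncard :=
  Real.log_le_log (by exact_mod_cast ncard_weightedBall_pos hS hw hR)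
    (by exact_mod_cast ncard_weightedBall_mono hS hw h)

theorem subadditive_log_ncard_weightedBall (hS : IsSymmGenSet S) {w : S → ℝ} (hw : IsWeight w) :
    Subadditive fun n : ℕ => Real.log (weightedBall w (n + ∑ s, w s)).ncard := by
  intro m n
  have hc := hw.sum_univ_nonneg
  have hm : (0 : ℝ) < (weightedBall w (m + ∑ s, w s)).ncard := by
    exact_mod_cast ncard_weightedBall_pos hS hw (by positivity)
  have hn : (0 : ℝ) < (weightedBall w (n + ∑ s, w s)).ncard := by
    exact_mod_cast ncard_weightedBall_pos hS hw (by positivity)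
  have hmn : (0 : ℝ) < (weightedBall w ((m + n : ℕ) + ∑ s, w s)).ncard := by
    exact_mod_cast ncard_weightedBall_pos hS hw (by positivity)
  rw [← Real.log_mul hm.ne' hn.ne']
  refine Real.log_le_log hmn ?_
  have h := ncard_weightedBall_add_le hS hw (R := m + ∑ s, w s) (R' := n) (by positivity)
    (by positivity)
  rw [show (m : ℝ) + ∑ s, w s + n = (m + n : ℕ) + ∑ s, w s by push_cast; ring] at h
  exact_mod_cast h

theorem exists_tendsto_log_ncard_div (hS : IsSymmGenSet S) {w : S → ℝ} (hw : IsWeight w) :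
    ∃ L : ℝ, Tendsto (fun R : ℝ => Real.log ((weightedBall w R).ncard : ℝ) / R) atTop (𝓝 L) := by
  set c := ∑ s, w s with hc
  have hc0 : 0 ≤ c := hw.sum_univ_nonneg
  set u : ℕ → ℝ := fun n => Real.log (weightedBall w (n + c)).ncard with hu
  have hsub : Subadditive u := subadditive_log_ncard_weightedBall hS hw
  have hbdd : BddBelow (Set.range fun n => u n / n) := by
    refine ⟨0, ?_⟩
    rintro _ ⟨n, rfl⟩
    exact div_nonneg (Real.log_natCast_nonneg _) (Nat.cast_nonneg n)
  have hlim := hsub.tendsto_lim hbdd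
  refine ⟨hsub.lim, ?_⟩
  have hsubc : Tendsto (fun R : ℝ => R - c) atTop atTop := tendsto_atTop_add_const_right _ _ tendsto_id
  -- `u n` refers to radius `n + c`, so rounding `R - c` down and `R` up gives radii on either side
  -- of `R`.
  have hlow : Tendsto (fun R : ℝ => u ⌊R - c⌋₊ / R) atTop (𝓝 hsub.lim) := by
    have h₁ := hlim.comp (tendsto_nat_floor_atTop.comp hsubc)
    have h₂ := (tendsto_nat_floor_div_atTop (R := ℝ)).comp hsubc
    have h₃ : Tendsto (fun R : ℝ => (R - c) / R) atTop (𝓝 1) := by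
      have : Tendsto (fun R : ℝ => 1 - c / R) atTop (𝓝 (1 - 0)) :=
        tendsto_const_nhds.sub (tendsto_const_nhds.div_atTop tendsto_id)
      rw [sub_zero] at this
      refine this.congr' ?_
      filter_upwards [eventually_gt_atTop 0] with R hR
      field_simp
    have h := (h₁.mul h₂).mul h₃
    rw [mul_one, mul_one] at h
    refine h.congr' ?_
    filter_upwards [eventually_ge_atTop (c + 1)] with R hR
    have h₄ : 0 < ⌊R - c⌋₊ := Nat.floor_pos.2 (by linarith)
    have h₅ : (0 : ℝ) < ⌊R - c⌋₊ := by exact_mod_cast h₄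
    have h₆ : R - c ≠ 0 := by linarith
    have h₇ : R ≠ 0 := by linarith
    simp only [Function.comp_apply]
    field_simp
  have hup : Tendsto (fun R : ℝ => u ⌈R⌉₊ / R) atTop (𝓝 hsub.lim) := by
    have h := (hlim.comp tendsto_nat_ceil_atTop).mul (tendsto_nat_ceil_div_atTop (R := ℝ))
    rw [mul_one] at h
    refine h.congr' ?_
    filter_upwards [eventually_gt_atTop 0] with R hR
    have h₄ : 0 < ⌈R⌉₊ := Nat.ceil_pos.2 hR
    have h₅ : (0 : ℝ) < ⌈R⌉₊ := by exact_mod_cast h₄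
    simp only [Function.comp_apply]
    field_simp
  refine tendsto_of_tendsto_of_tendsto_of_le_of_le' hlow hup ?_ ?_
  · filter_upwards [eventually_ge_atTop (c + 1)] with R hR
    have h := Nat.floor_le (a := R - c) (by linarith)
    exact div_le_div_of_nonneg_right
      (log_ncard_weightedBall_mono hS hw (by positivity) (by linarith)) (by linarith)
  · filter_upwards [eventually_ge_atTop 0] with R hR
    have h := Nat.le_ceil R
    exact div_le_div_of_nonneg_right
      (log_ncard_weightedBall_mono hS hw hR (by linarith)) hR

/-- The limit that defines the volume entropy exists. -/
theorem tendsto_volumeEntropy (hS : IsSymmGenSet S) {w : S → ℝ} (hw : IsWeight w) :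
    Tendsto (fun R : ℝ => Real.log ((weightedBall w R).ncard : ℝ) / R) atTop
      (𝓝 (volumeEntropy w)) :=
  tendsto_nhds_limUnder (exists_tendsto_log_ncard_div hS hw)

theorem volumeEntropy_nonneg (hS : IsSymmGenSet S) {w : S → ℝ} (hw : IsWeight w) :
    0 ≤ volumeEntropy w := by
  refine ge_of_tendsto (tendsto_volumeEntropy hS hw) ?_
  filter_upwards [eventually_ge_atTop 0] with R hR
  exact div_nonneg (Real.log_natCast_nonneg _) hR

theorem weightedDist_le_mul (hS : IsSymmGenSet S) {w w' : S → ℝ} (hw : IsWeight w)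
    (hw' : IsWeight w') {a : ℝ} (h : ∀ s, w s ≤ a * w' s) (x y : G) :
    weightedDist w x y ≤ a * weightedDist w' x y := by
  obtain ⟨l, hl, hl'⟩ := exists_word_eq_weightedDist hS hw' x y
  refine (weightedDist_le_of_word hS hw l hl).trans ?_
  rw [← hl', ← List.sum_map_mul_left]
  exact List.sum_le_sum fun s _ => h s

/-- The `w'`-ball of radius `R` lies in the `w`-ball of radius `a * R`. -/
theorem volumeEntropy_le_mul (hS : IsSymmGenSet S) {w w' : S → ℝ} (hw : IsWeight w)
    (hw' : IsWeight w') {a : ℝ} (ha : 0 < a) (h : ∀ s, w s ≤ a * w' s) :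
    volumeEntropy w' ≤ a * volumeEntropy w := by
  have h₁ := ((tendsto_volumeEntropy hS hw).comp (tendsto_id.const_mul_atTop ha)).const_mul a
  refine le_of_tendsto_of_tendsto (tendsto_volumeEntropy hS hw') h₁ ?_
  filter_upwards [eventually_gt_atTop 0] with R hR
  have h₂ : Real.log (weightedBall w' R).ncard ≤ Real.log (weightedBall w (a * R)).ncard := by
    refine Real.log_le_log (by exact_mod_cast ncard_weightedBall_pos hS hw' hR.le) ?_
    refine Nat.cast_le.2 (Set.ncard_le_ncard (fun x hx => ?_) (finite_weightedBall hS hw _))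
    exact (weightedDist_le_mul hS hw hw' h x 1).trans (mul_le_mul_of_nonneg_left hx ha.le)
  have h₃ : a * (Real.log (weightedBall w (a * R)).ncard / (a * R)) =
      Real.log (weightedBall w (a * R)).ncard / R := by field_simp
  simp only [Function.comp_apply, id_eq]
  rw [h₃]
  exact div_le_div_of_nonneg_right h₂ hR.le

/-- For any `a > 1`, weights `v` near `w` satisfy `v ≤ a * w`, hence have entropy at least
`volumeEntropy w / a`. -/
theorem lowerSemicontinuousOn_volumeEntropy (hS : IsSymmGenSet S) :
    LowerSemicontinuousOn volumeEntropy {w : S → ℝ | IsWeight w} := by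
  intro w hw y hy
  have hlim : Tendsto (fun a : ℝ => volumeEntropy w / a) (𝓝[>] 1) (𝓝 (volumeEntropy w / 1)) :=
    (tendsto_const_nhds.div tendsto_id one_ne_zero).mono_left nhdsWithin_le_nhds
  rw [div_one] at hlim
  obtain ⟨a, hya, ha⟩ := ((hlim.eventually (lt_mem_nhds hy)).and self_mem_nhdsWithin).exists
  have ha : 1 < a := ha
  have hev : ∀ᶠ v : S → ℝ in 𝓝 w, ∀ s, v s < a * w s := by
    refine eventually_all.2 fun s => ?_
    exact ((continuous_apply s).tendsto w).eventually
      (gt_mem_nhds (by nlinarith [hw.pos s]))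
  filter_upwards [nhdsWithin_le_nhds hev, self_mem_nhdsWithin] with v hv hvw
  refine hya.trans_le ?_
  rw [div_le_iff₀ (by linarith), mul_comm]
  exact volumeEntropy_le_mul hS hvw hw (by linarith) fun s => (hv s).le

theorem isCompact_normalizedWeights_ge (S : Finset G) {δ : ℝ} (hδ : 0 < δ) :
    IsCompact (normalizedWeights S ∩ {w | ∀ s, δ ≤ w s}) := by
  have heq : normalizedWeights S ∩ {w | ∀ s, δ ≤ w s} =
      (Set.univ.pi fun _ => Set.Icc δ 1) ∩ ((⋂ (s : S) (t : S) (_ : (t : G) = (s : G)⁻¹),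
        {w | w t = w s}) ∩ {w | ∑ s, w s = 1}) := by
    ext w
    simp only [Set.mem_inter_iff, Set.mem_pi, Set.mem_univ, true_imp_iff, Set.mem_Icc,
      Set.mem_iInter, Set.mem_ofPred_eq, normalizedWeights]
    constructor
    · rintro ⟨⟨hw, hsum⟩, hge⟩
      exact ⟨fun s => ⟨hge s, (hw.le_sum s).trans_eq hsum⟩, hw.symm, hsum⟩
    · rintro ⟨hge, hsymm, hsum⟩
      exact ⟨⟨⟨fun s => hδ.trans_le (hge s).1, hsymm⟩, hsum⟩, fun s => (hge s).1⟩
  rw [heq]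
  refine (isCompact_univ_pi fun _ => isCompact_Icc).inter_right (IsClosed.inter ?_ ?_)
  · exact isClosed_iInter fun s => isClosed_iInter fun t => isClosed_iInter fun _ =>
      isClosed_eq (continuous_apply t) (continuous_apply s)
  · exact isClosed_eq (continuous_finsetSum _ fun s _ => continuous_apply s) continuous_const

theorem normalizedWeights_nonempty [Nonempty S] : (normalizedWeights S).Nonempty := by
  have h : (0 : ℝ) < Fintype.card S := by exact_mod_cast Fintype.card_pos
  refine ⟨fun _ => (Fintype.card S : ℝ)⁻¹, ⟨fun _ => inv_pos.2 h, fun _ _ _ => rfl⟩, ?_⟩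
  rw [Finset.sum_const, Finset.card_univ, nsmul_eq_mul, mul_inv_cancel₀ h.ne']

/-- If the entropy blows up as the least weight tends to zero, then it attains its infimum. -/
theorem exists_isLeast_volumeEntropy (hS : IsSymmGenSet S) [Nonempty S]
    (hproper : ∀ N : ℝ, 0 < N → ∃ δ : ℝ, 0 < δ ∧
      ∀ w ∈ normalizedWeights S, (⨅ s, w s) < δ → N < volumeEntropy w) :
    ∃ w ∈ normalizedWeights S,
      IsLeast (volumeEntropy '' normalizedWeights S) (volumeEntropy w) := by
  obtain ⟨w₀, hw₀⟩ := normalizedWeights_nonempty (S := S)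
  obtain ⟨δ, hδ, h⟩ := hproper (volumeEntropy w₀ + 1)
    (by linarith [volumeEntropy_nonneg hS hw₀.1])
  have hmem : ∀ w ∈ normalizedWeights S, volumeEntropy w ≤ volumeEntropy w₀ →
      w ∈ normalizedWeights S ∩ {w | ∀ s, δ ≤ w s} := by
    refine fun w hw hle => ⟨hw, fun s => ?_⟩
    have : δ ≤ ⨅ s, w s := by
      by_contra! hlt
      linarith [h w hw hlt]
    exact this.trans (ciInf_le (Set.finite_range w).bddBelow s)
  obtain ⟨w, hw, hmin⟩ := LowerSemicontinuousOn.exists_isMinOn ⟨w₀, hmem w₀ hw₀ le_rfl⟩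
    (isCompact_normalizedWeights_ge S hδ)
    ((lowerSemicontinuousOn_volumeEntropy hS).mono fun w hw => hw.1.1)
  refine ⟨w, hw.1, ⟨w, hw.1, rfl⟩, ?_⟩
  rintro _ ⟨v, hv, rfl⟩
  rcases le_total (volumeEntropy v) (volumeEntropy w₀) with hle | hle
  · exact hmin (hmem v hv hle)
  · exact (hmin (hmem w₀ hw₀ le_rfl)).trans hle

/-- Products of `r` factors of weight at most `C`, chosen from `M` factors that span a free
semigroup, force the entropy to be at least `log M / C`. -/
theorem log_div_le_volumeEntropy (hS : IsSymmGenSet S) {w : S → ℝ} (hw : IsWeight w) {C : ℝ}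
    (hC : 0 < C) {M : ℕ} (hM : 0 < M) {a : ℕ → G} (ha : ∀ k < M, weightedDist w (a k) 1 ≤ C)
    (hinj : ∀ l l' : List ℕ, l.length = l'.length → (l.map a).prod = (l'.map a).prod → l = l') :
    Real.log M / C ≤ volumeEntropy w := by
  have hseq : Tendsto (fun r : ℕ => (r : ℝ) * C) atTop atTop :=
    tendsto_natCast_atTop_atTop.atTop_mul_const hC
  refine ge_of_tendsto ((tendsto_volumeEntropy hS hw).comp hseq) ?_
  filter_upwards [eventually_gt_atTop 0] with r hr
  have hr' : (0 : ℝ) < r := by exact_mod_cast hr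
  have hprod : ∀ l : List ℕ, (∀ k ∈ l, k < M) →
      weightedDist w (l.map a).prod 1 ≤ l.length * C := by
    intro l
    induction l with
    | nil => intro _; simp [weightedDist_self hS hw]
    | cons k l ih =>
      intro hl
      have h₁ := ih fun j hj => hl j (List.mem_cons_of_mem k hj)
      have h₂ := ha k (hl k List.mem_cons_self)
      have h₃ := weightedDist_triangle hS hw (a k * (l.map a).prod) (a k) 1
      have h₄ := weightedDist_mul_left w (a k) (l.map a).prod 1
      rw [mul_one] at h₄
      rw [List.map_cons, List.prod_cons, List.length_cons]
      push_cast
      linarith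
  let f : (Fin r → Fin M) → G := fun v => ((List.ofFn fun i => (v i : ℕ)).map a).prod
  have hf : Function.Injective f := by
    intro v v' hvv
    have := List.ofFn_injective (hinj _ _ (by simp) hvv)
    funext i
    exact Fin.ext (congrFun this i)
  have hcard : M ^ r ≤ (weightedBall w (r * C)).ncard := by
    have hsub : Set.range f ⊆ weightedBall w (r * C) := by
      rintro _ ⟨v, rfl⟩
      have := hprod (List.ofFn fun i => (v i : ℕ)) (by
        intro k hk
        obtain ⟨i, rfl⟩ := (List.mem_ofFn' _ _).1 hk
        exact (v i).2)
      rwa [List.length_ofFn] at this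
    refine le_trans ?_ (Set.ncard_le_ncard hsub (finite_weightedBall hS hw _))
    rw [← Set.image_univ, Set.ncard_image_of_injective _ hf, Set.ncard_univ]
    simp
  rw [Function.comp_apply, div_le_div_iff₀ hC (by positivity)]
  have hlog : r * Real.log M ≤ Real.log (weightedBall w (r * C)).ncard := by
    rw [← Real.log_pow]
    exact Real.log_le_log (by positivity) (by exact_mod_cast hcard)
  nlinarith

theorem weightedDist_le_length (hS : IsSymmGenSet S) {w : S → ℝ} (hw : w ∈ normalizedWeights S)
    (l : List S) : weightedDist w (l.map (fun s : S => (s : G))).prod 1 ≤ l.length := by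
  refine (weightedDist_le_of_word hS hw.1 l (by simp)).trans ?_
  refine (List.sum_le_card_nsmul (l.map w) 1 fun x hx => ?_).trans_eq (by simp)
  obtain ⟨s, -, rfl⟩ := List.mem_map.1 hx
  exact (hw.1.le_sum s).trans_eq hw.2

/-- Normalized letters weigh at most `1`, so `b` costs at most its word length whatever `w` is. Once
`w s < 1 / (q * M)`, each of the first `M` powers of `s` costs at most `1`, which explains `C`. -/
theorem exists_lt_volumeEntropy_of_weight_lt (hG : IsHyperbolicGroup G) (hne : IsNonElementary G)
    (hS : IsSymmGenSet S) (s : S) (hs : ¬ IsOfFinOrder (s : G)) (N : ℝ) :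
    ∃ δ : ℝ, 0 < δ ∧ ∀ w ∈ normalizedWeights S, w s < δ → N < volumeEntropy w := by
  obtain ⟨b, q, hq, hinj⟩ := hG.exists_prod_injective hne hs
  obtain ⟨_, l, hl, -⟩ := wordWeights_nonempty hS (fun _ : S => (1 : ℝ)) b
  set C : ℝ := l.length + 1 with hC
  have hC0 : 0 < C := by positivity
  obtain ⟨M, hM⟩ := ((Real.tendsto_log_atTop.comp tendsto_natCast_atTop_atTop).eventually
    (eventually_gt_atTop (N * C)) |>.and (eventually_gt_atTop 0)).exists
  obtain ⟨hM, hM0⟩ := hM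
  have hqM : (0 : ℝ) < q * M := by positivity
  refine ⟨1 / (q * M), by positivity, fun w hw hws => ?_⟩
  refine ((lt_div_iff₀ hC0).2 hM).trans_le
    (log_div_le_volumeEntropy hS hw.1 hC0 hM0 (fun k hk => ?_) hinj)
  have h₁ := weightedDist_triangle hS hw.1 (b * (s : G) ^ (q * (k + 1))) b 1
  have h₂ := weightedDist_mul_left w b ((s : G) ^ (q * (k + 1))) 1
  have h₃ : weightedDist w ((s : G) ^ (q * (k + 1))) 1 ≤ (q * (k + 1) : ℕ) * w s :=
    (weightedDist_le_of_word hS hw.1 (List.replicate (q * (k + 1)) s) (by simp)).trans_eq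
      (by simp)
  have h₄ : weightedDist w b 1 ≤ l.length := hl ▸ weightedDist_le_length hS hw l
  have h₅ : ((q * (k + 1) : ℕ) : ℝ) ≤ q * M := by
    exact_mod_cast Nat.mul_le_mul_left q hk
  have h₆ : ((q * (k + 1) : ℕ) : ℝ) * w s ≤ 1 := by
    refine (mul_le_mul h₅ hws.le (hw.1.pos s).le hqM.le).trans_eq ?_
    field_simp
  rw [mul_one] at h₂
  linarith

theorem exists_lt_volumeEntropy (hG : IsHyperbolicGroup G) (hne : IsNonElementary G)
    (hS : IsSymmGenSet S) [Nonempty S] (hord : ∀ s : S, ¬ IsOfFinOrder (s : G)) (N : ℝ) :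
    ∃ δ : ℝ, 0 < δ ∧ ∀ w ∈ normalizedWeights S, (⨅ s, w s) < δ → N < volumeEntropy w := by
  choose δ hδ h using fun s => exists_lt_volumeEntropy_of_weight_lt hG hne hS s (hord s) N
  obtain ⟨s₀, hs₀⟩ := Finite.exists_min δ
  refine ⟨δ s₀, hδ s₀, fun w hw hlt => ?_⟩
  obtain ⟨s, hs⟩ := exists_lt_of_ciInf_lt hlt
  exact h s w hw (hs.trans_le (hs₀ s))

theorem IsSymmGenSet.nonempty [Infinite G] (hS : IsSymmGenSet S) : Nonempty S := by
  by_contra hempty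
  have hS' : S = ∅ := Finset.eq_empty_of_forall_notMem fun s hs => hempty ⟨⟨s, hs⟩⟩
  have h := hS.closure_eq_top
  rw [hS', Finset.coe_empty, Subgroup.closure_empty] at h
  obtain ⟨g, hg⟩ := exists_ne (1 : G)
  exact hg (Subgroup.mem_bot.1 (h ▸ Subgroup.mem_top g))

end Entropy

end WeightedWord

theorem mainTheorem6 {G : Type*} [Group G] (hG : IsHyperbolicGroup G)
    (hne : IsNonElementary G) (htf : IsTorsionFreeGroup G)
    (S : Finset G) (hS : IsSymmGenSet S) (h1 : (1 : G) ∉ S) :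
    (∀ w : S → ℝ, IsWeight w →
      Tendsto (fun R : ℝ => Real.log ((weightedBall w R).ncard : ℝ) / R) atTop
        (𝓝 (volumeEntropy w))) ∧
    (∀ N : ℝ, 0 < N → ∃ δ : ℝ, 0 < δ ∧
      ∀ w ∈ normalizedWeights S, (⨅ s, w s) < δ → N < volumeEntropy w) ∧
    (∃ w ∈ normalizedWeights S,
      IsLeast (volumeEntropy '' normalizedWeights S) (volumeEntropy w)) := by
  have := hne.1
  have := hS.nonempty
  have hproper : ∀ N : ℝ, 0 < N → ∃ δ : ℝ, 0 < δ ∧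
      ∀ w ∈ normalizedWeights S, (⨅ s, w s) < δ → N < volumeEntropy w := fun N _ =>
    exists_lt_volumeEntropy hG hne hS (fun s hs => h1 (htf s hs ▸ s.2)) N
  exact ⟨fun w hw => tendsto_volumeEntropy hS hw, hproper, exists_isLeast_volumeEntropy hS hproper⟩
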